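/- Let $n\ge 1$ and let $C_{2n+1}$ be the cycle with vertex set $\mathbb{Z}/(2n+1)\mathbb{Z}$. For a set $R$ of ordered pairs of distinct vertices (arcs), let $\operatorname{DE}(R)=\operatorname{conv}\{e_v-e_w : (v,w)\in R\}\subset\mathbb{R}^{2n+1}$. Put $Q^+=\{(i-1,i)\}$, $Q^-=\{(i,i-1)\}$ ($i\in\mathbb{Z}/(2n+1)\mathbb{Z}$), $Q=Q^+\cup Q^-$, and let $\operatorname{SE}(C_{2n+1})=\operatorname{DE}(Q)$ be the symmetric edge polytope of $C_{2n+1}$. For $R\subseteq Q$ put $R^\pm=R\cap Q^\pm$, let $-R$ be the set of reversed arcs, and let $c(R)$ be the number of vertices minus the number of connected components of the graph $(\mathbb{Z}/(2n+1)\mathbb{Z},R)$ with directions forgotten. Faces are nonempty; a facet is a face of codimension one; $f_d$ is the number of $d$-dimensional faces of $\operatorname{SE}(C_{2n+1})$. Then: 1. $\operatorname{SE}(C_{2n+1})$ has dimension $2n$. 2. For $R\subseteq Q$ with $\dim\operatorname{DE}(R)=2n-1$, $\operatorname{DE}(R)$ is a facet of $\operatorname{SE}(C_{2n+1})$ if and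 only if $c(R)=c(Q)$, $|R^+|=|R^-|=n$ and $R^+\cap(-R^-)=\emptyset$. 3. Every facet is a $(2n-1)$-simplex and every proper face is a simplex, i.e. $\operatorname{SE}(C_{2n+1})$ is a simplicial polytope. 4. The map $(E,e)\mapsto \operatorname{DE}\bigl(E\cup (Q^-\setminus(-E))\setminus\{e\}\bigr)$ is a bijection from the pairs $(E,e)$ with $E\subseteq Q^+$, $|E|=n$, $e\in Q^-\setminus(-E)$ onto the set of facets. The number of facets is $$f_{2n-1}=(n+1)\binom{2n+1}{n}=\frac{(2n+1)!}{n!\,n!}=(2n+1)\binom{2n}{n}.$$ 5. Let $0\le d<2n-2$. For $R\subseteq Q$, $\operatorname{DE}(R)$ is a face of $\operatorname{SE}(C_{2n+1})$ of dimension $d$ if and only if $|R|=d+1$, $|R^+|\le n$, $|R^-|\le n$ and $R^+\cap(-R^-)=\emptyset$. Moreover $$f_d=\sum_{i\in I}\binom{2n+1}{i}\binom{2n+1-i}{d+1-i}=\binom{2n+1}{d+1}\sum_{i\in I}\binom{d+1}{i},\qquad I=\{i\in\mathbb{Z} : i\le n,\ d+1-i\le n\},$$ where binomial coefficients with a negative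 lower entry are $0$. 6. If $d\ge 0$ and $d+1<n$, then $\sum_{i\in I}\binom{d+1}{i}=2^{d+1}$ and $f_d=\binom{2n+1}{d+1}2^{d+1}$. -/

import Mathlib

/-! A quiver on a fixed finite vertex set `V` (no loops, no multiple edges) is given by its finite
set of arcs `R : Finset (V × V)`; an arc `(v, w)` goes from `v` to `w`. The subquivers of `Q` with
the same vertex set as `Q` ("lluf" subquivers) are the `R` with `R ⊆ Q`. -/

namespace SymEdge

open Finset

noncomputable section

/-- The vector `ε_(v,w) = e_v - e_w` of `ℝ^V`. -/
def arcVec {V : Type*} [DecidableEq V] (e : V × V) : V → ℝ :=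
  Pi.single e.1 1 - Pi.single e.2 1

/-- The directed edge polytope of the quiver with arc set `R`. -/
def DE {V : Type*} [DecidableEq V] (R : Finset (V × V)) : Set (V → ℝ) :=
  convexHull ℝ (arcVec '' (R : Set (V × V)))

/-- The arc set of the double of a graph: each edge is replaced by its two arcs. -/
def double {V : Type*} [Fintype V] (G : SimpleGraph V) [DecidableRel G.Adj] : Finset (V × V) :=
  univ.filter fun e => G.Adj e.1 e.2

/-- The symmetric edge polytope of a graph. -/
def SE {V : Type*} [Fintype V] [DecidableEq V] (G : SimpleGraph V) [DecidableRel G.Adj] :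
    Set (V → ℝ) :=
  DE (double G)

/-- The underlying graph of a quiver (parallel edges do not matter for connectivity). -/
def underlying {V : Type*} (R : Finset (V × V)) : SimpleGraph V :=
  SimpleGraph.fromRel fun v w => (v, w) ∈ R

/-- The coconnectivity: number of vertices minus number of connected components. -/
def coconnectivity {V : Type*} [Fintype V] (R : Finset (V × V)) : ℕ :=
  Fintype.card V - Nat.card (underlying R).ConnectedComponent

/-- The dimension of a nonempty convex set: the dimension of its affine span. -/
def polyDim {E : Type*} [AddCommGroup E] [Module ℝ E] (P : Set E) : ℕ :=
  Module.finrank ℝ (vectorSpan ℝ P)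

/-- `F` is a (nonempty) face of `P` of dimension `d`; faces are the sets of maximizers on `P` of
linear functionals. -/
def IsFaceOfDim {V : Type*} (P : Set (V → ℝ)) (d : ℕ) (F : Set (V → ℝ)) : Prop :=
  F.Nonempty ∧ IsExposed ℝ P F ∧ polyDim F = d

/-- `F` is a facet of `P`: a (nonempty) face of codimension one. -/
def IsFacet {V : Type*} (P F : Set (V → ℝ)) : Prop :=
  F.Nonempty ∧ IsExposed ℝ P F ∧ polyDim F + 1 = polyDim P

/-- `F` is a `d`-simplex: the convex hull of `d + 1` affinely independent points. -/
def IsSimplexOfDim {V : Type*} (d : ℕ) (F : Set (V → ℝ)) : Prop :=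
  ∃ p : Fin (d + 1) → V → ℝ, AffineIndependent ℝ p ∧ F = convexHull ℝ (Set.range p)

/-- Every nonempty proper face of `P` is a simplex. -/
def IsSimplicial {V : Type*} (P : Set (V → ℝ)) : Prop :=
  ∀ F : Set (V → ℝ), F.Nonempty → IsExposed ℝ P F → F ≠ P → ∃ d, IsSimplexOfDim d F

/-- The number of faces of `P` of dimension `d`. -/
def faceCount {V : Type*} (P : Set (V → ℝ)) (d : ℕ) : ℕ :=
  Set.ncard {F | IsFaceOfDim P d F}

/-- The vertex set `ℤ/(2n+1)ℤ` of the odd cycle. -/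
abbrev OddVertex (n : ℕ) : Type := Fin (2 * n + 1)

/-- The arcs of the double of the cycle `C_{2n+1}`. -/
def oddArcs (n : ℕ) : Finset (OddVertex n × OddVertex n) :=
  double (SimpleGraph.cycleGraph (2 * n + 1))

/-- The arcs `(i - 1, i)`. -/
def posArcs (n : ℕ) : Finset (OddVertex n × OddVertex n) :=
  univ.image fun i => (i - 1, i)

/-- The arcs `(i, i - 1)`. -/
def negArcs (n : ℕ) : Finset (OddVertex n × OddVertex n) :=
  univ.image fun i => (i, i - 1)

/-- The set of reversed arcs. -/
def rev {V : Type*} [DecidableEq V] (R : Finset (V × V)) : Finset (V × V) :=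
  R.image Prod.swap

/-- The integers `i` with `i ≤ n` and `d + 1 - i ≤ n`; only those with `0 ≤ i ≤ d + 1` are kept,
since `Nat.choose (d + 1) i` vanishes for all others. -/
def indexSet (n d : ℕ) : Finset ℕ :=
  (range (d + 2)).filter fun i => i ≤ n ∧ d + 1 ≤ n + i

end

end SymEdge

/-! Let `edgeVec i` be the vector of the arc `(i - 1, i)`. The polytope is the convex hull of the
vectors `± edgeVec i`, and up to scaling the only linear relation among the `edgeVec i` is that
their sum is zero. Hence the dimension is `2n`, and the values `x i` of a linear functional on the
edge vectors are arbitrary real numbers with sum zero.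

A functional that is nonzero on some edge vector has maximum `M = max |x i| > 0`, attained on the
positive arcs over `P = {x i = M}` and the negative arcs over `N = {x i = -M}`. These sets are
disjoint, and since the sum is zero over an odd number of indices, each has at most `n` elements
(`exists_arcsOf_of_isExposed`). Conversely, for such `P` and `N`, put `1` on `P`, `-1` on `N` and a
suitable constant in `(-1, 1)` elsewhere (`exists_functional_eq_one_iff`). The chosen vectors omit
an edge, so they are linearly independent and span a simplex (`linearIndepOn_arcsOf`). Distinct
pairs give distinct faces (`DE_injOn`), so everything reduces to counting pairs `(P, N)`. -/

namespace SymEdge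

open Finset

/-! ### Faces and simplices of directed edge polytopes -/

section General

variable {V : Type*} [DecidableEq V]

theorem DE_mono {R S : Finset (V × V)} (h : R ⊆ S) : DE R ⊆ DE S :=
  convexHull_mono (Set.image_mono (by exact_mod_cast h))

theorem arcVec_mem_DE {R : Finset (V × V)} {e : V × V} (he : e ∈ R) : arcVec e ∈ DE R :=
  subset_convexHull ℝ _ ⟨e, he, rfl⟩

theorem DE_nonempty {R : Finset (V × V)} (h : R.Nonempty) : (DE R).Nonempty :=
  let ⟨_, he⟩ := h
  ⟨_, arcVec_mem_DE he⟩

theorem nonempty_of_DE_nonempty {R : Finset (V × V)} (h : (DE R).Nonempty) : R.Nonempty := by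
  unfold DE at h
  rw [convexHull_nonempty_iff, Set.image_nonempty] at h
  exact_mod_cast h

/-- The values of a linear functional on a directed edge polytope are bounded by its maximum over
the generators, and where the bound is attained the point is spanned by the maximal generators. -/
theorem le_and_mem_DE_filter {R : Finset (V × V)} (l : (V → ℝ) →ₗ[ℝ] ℝ) {M : ℝ}
    [DecidablePred fun e : V × V => l (arcVec e) = M]
    (hM : ∀ e ∈ R, l (arcVec e) ≤ M) {x : V → ℝ} (hx : x ∈ DE R) :
    l x ≤ M ∧ (l x = M → x ∈ DE (R.filter fun e => l (arcVec e) = M)) := by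
  let T : Set (V → ℝ) :=
    {x | l x ≤ M ∧ (l x = M → x ∈ DE (R.filter fun e => l (arcVec e) = M))}
  suffices h : DE R ⊆ T from h hx
  refine convexHull_min ?_ ?_
  · rintro _ ⟨e, he, rfl⟩
    exact ⟨hM e he, fun h => arcVec_mem_DE (mem_filter.2 ⟨he, h⟩)⟩
  · rintro x ⟨hx, hx'⟩ y ⟨hy, hy'⟩ a b ha hb hab
    have hl : l (a • x + b • y) = a * l x + b * l y := by simp
    refine ⟨?_, fun h => ?_⟩
    · rw [hl]
      calc a * l x + b * l y ≤ a * M + b * M := by gcongr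
        _ = M := by rw [← add_mul, hab, one_mul]
    · rw [hl] at h
      rcases ha.eq_or_lt with rfl | ha
      · have : b = 1 := by linarith
        subst this
        simpa using hy' (by simpa using h)
      rcases hb.eq_or_lt with rfl | hb
      · have : a = 1 := by linarith
        subst this
        simpa using hx' (by simpa using h)
      have hM' : M = a * M + b * M := by rw [← add_mul, hab, one_mul]
      have h1 : l x = M := by
        by_contra hne
        have := mul_lt_mul_of_pos_left (lt_of_le_of_ne hx hne) ha
        have := mul_le_mul_of_nonneg_left hy hb.le
        linarith
      have h2 : l y = M := by
        by_contra hne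
        have := mul_lt_mul_of_pos_left (lt_of_le_of_ne hy hne) hb
        have := mul_le_mul_of_nonneg_left hx ha.le
        linarith
      exact convex_convexHull ℝ _ (hx' h1) (hy' h2) ha.le hb.le hab

/-- The face on which a linear functional is maximal is spanned by the maximal generators. -/
theorem maximizers_DE {R : Finset (V × V)} (l : (V → ℝ) →ₗ[ℝ] ℝ) {M : ℝ}
    [DecidablePred fun e : V × V => l (arcVec e) = M]
    (hM : ∀ e ∈ R, l (arcVec e) ≤ M) (hM' : ∃ e ∈ R, l (arcVec e) = M) :
    {x ∈ DE R | ∀ y ∈ DE R, l y ≤ l x} = DE (R.filter fun e => l (arcVec e) = M) := by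
  obtain ⟨e, he, hle⟩ := hM'
  ext x
  constructor
  · rintro ⟨hx, hmax⟩
    obtain ⟨h1, h2⟩ := le_and_mem_DE_filter l hM hx
    exact h2 (le_antisymm h1 (hle ▸ hmax _ (arcVec_mem_DE he)))
  · intro hx
    have hx' := DE_mono (filter_subset _ _) hx
    refine ⟨hx', fun y hy => (le_and_mem_DE_filter l hM hy).1.trans ?_⟩
    have : DE (R.filter fun e => l (arcVec e) = M) ⊆ {x | M ≤ l x} := by
      refine convexHull_min ?_ (convex_halfSpace_ge l.isLinear M)
      rintro _ ⟨e, he, rfl⟩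
      exact (mem_filter.1 he).2.ge
    exact this hx

theorem vectorSpan_DE (R : Finset (V × V)) :
    vectorSpan ℝ (DE R) = vectorSpan ℝ (arcVec '' (R : Set (V × V))) := by
  rw [← direction_affineSpan, ← direction_affineSpan, DE, affineSpan_convexHull]

theorem polyDim_DE_of_linearIndepOn {R : Finset (V × V)} {d : ℕ}
    (h : LinearIndepOn ℝ arcVec (R : Set (V × V))) (hd : R.card = d + 1) :
    polyDim (DE R) = d := by
  have h' := LinearIndependent.affineIndependent (k := ℝ) h
  have := h'.finrank_vectorSpan (n := d) (by simpa using hd)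
  rw [polyDim, vectorSpan_DE, Set.image_eq_range]
  exact this

theorem isSimplexOfDim_DE_of_linearIndepOn {R : Finset (V × V)} {d : ℕ}
    (h : LinearIndepOn ℝ arcVec (R : Set (V × V))) (hd : R.card = d + 1) :
    IsSimplexOfDim d (DE R) := by
  have h' := LinearIndependent.affineIndependent (k := ℝ) h
  let φ := R.equivFinOfCardEq hd
  refine ⟨fun i => arcVec (φ.symm i : V × V), ?_, ?_⟩
  · exact (affineIndependent_equiv φ.symm).2 h'
  · rw [DE]
    congr 1
    ext x
    constructor
    · rintro ⟨e, he, rfl⟩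
      exact ⟨φ ⟨e, he⟩, by simp⟩
    · rintro ⟨i, rfl⟩
      exact ⟨_, (φ.symm i).2, rfl⟩

end General

/-! ### Arc sets of the odd cycle as pairs of vertex sets -/

section OddCycle

variable {n : ℕ}

/-- The arcs `(i - 1, i)` for `i ∈ P` together with the arcs `(i, i - 1)` for `i ∈ N`. -/
def arcsOf (P N : Finset (OddVertex n)) : Finset (OddVertex n × OddVertex n) :=
  P.image (fun i => (i - 1, i)) ∪ N.image (fun i => (i, i - 1))

/-- There are at least three vertices, so `2 ≠ 0`. This keeps the two orientations of an edge apart.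
-/
theorem one_ne_neg_one (hn : 1 ≤ n) : (1 : OddVertex n) ≠ -1 := by
  obtain ⟨m, rfl⟩ : ∃ m, n = m + 1 := ⟨n - 1, by omega⟩
  intro h
  have := congrArg Fin.val h
  rw [Fin.val_neg'] at this
  have h1 : ((1 : OddVertex (m + 1)) : ℕ) = 1 := by
    rw [Fin.val_one']; exact Nat.mod_eq_of_lt (by omega)
  rw [h1, Nat.mod_eq_of_lt (by omega)] at this
  omega

theorem posArc_ne_negArc (hn : 1 ≤ n) (i j : OddVertex n) : (i - 1, i) ≠ (j, j - 1) := by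
  intro h
  obtain ⟨h1, h2⟩ := Prod.mk.inj h
  refine one_ne_neg_one hn ?_
  have : i = i - 1 - 1 := by rw [h1]; exact h2
  have h3 : i - 1 + 1 = i - 1 - 1 := by rw [sub_add_cancel]; exact this
  rw [sub_eq_add_neg (i - 1)] at h3
  exact add_left_cancel h3

theorem posArc_injective : Function.Injective fun i : OddVertex n => (i - 1, i) :=
  fun _ _ h => (Prod.mk.inj h).2

theorem negArc_injective : Function.Injective fun i : OddVertex n => (i, i - 1) :=
  fun _ _ h => (Prod.mk.inj h).1

theorem posArc_mem_arcsOf (hn : 1 ≤ n) {P N : Finset (OddVertex n)} {i : OddVertex n} :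
    (i - 1, i) ∈ arcsOf P N ↔ i ∈ P := by
  simp only [arcsOf, mem_union, mem_image]
  constructor
  · rintro (⟨j, hj, h⟩ | ⟨j, _, h⟩)
    · rwa [← posArc_injective h]
    · exact (posArc_ne_negArc hn i j h.symm).elim
  · exact fun h => Or.inl ⟨i, h, rfl⟩

theorem negArc_mem_arcsOf (hn : 1 ≤ n) {P N : Finset (OddVertex n)} {i : OddVertex n} :
    (i, i - 1) ∈ arcsOf P N ↔ i ∈ N := by
  simp only [arcsOf, mem_union, mem_image]
  constructor
  · rintro (⟨j, _, h⟩ | ⟨j, hj, h⟩)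
    · exact (posArc_ne_negArc hn j i h).elim
    · rwa [← negArc_injective h]
  · exact fun h => Or.inr ⟨i, h, rfl⟩

theorem arcsOf_inj (hn : 1 ≤ n) {P N P' N' : Finset (OddVertex n)}
    (h : arcsOf P N = arcsOf P' N') : P = P' ∧ N = N' := by
  constructor
  · ext i; rw [← posArc_mem_arcsOf hn (N := N), h, posArc_mem_arcsOf hn]
  · ext i; rw [← negArc_mem_arcsOf hn (P := P), h, negArc_mem_arcsOf hn]

theorem oddArcs_eq (hn : 1 ≤ n) : oddArcs n = arcsOf univ univ := by
  have h1 : ((1 : OddVertex n) : ℕ) = 1 := by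
    rw [Fin.val_one']; exact Nat.mod_eq_of_lt (by omega)
  have key : ∀ u v : OddVertex n, (u - v).val = 1 ↔ v = u - 1 := by
    intro u v
    have h2 : (u - v).val = 1 ↔ (u - v).val = (1 : OddVertex n).val :=
      ⟨fun h => h.trans h1.symm, fun h => h.trans h1⟩
    rw [h2, Fin.val_inj, sub_eq_iff_eq_add, eq_sub_iff_add_eq,
      add_comm (1 : OddVertex n)]
    exact eq_comm
  ext ⟨v, w⟩
  simp only [oddArcs, double, mem_filter, mem_univ, true_and, SimpleGraph.cycleGraph_adj', arcsOf,
    mem_union, mem_image, Prod.mk.injEq, key]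
  constructor
  · rintro (rfl | rfl)
    · exact Or.inr ⟨v, rfl, rfl⟩
    · exact Or.inl ⟨w, rfl, rfl⟩
  · rintro (⟨i, rfl, rfl⟩ | ⟨i, rfl, rfl⟩)
    · exact Or.inr rfl
    · exact Or.inl rfl

theorem SE_eq (n : ℕ) : SE (SimpleGraph.cycleGraph (2 * n + 1)) = DE (oddArcs n) := rfl

theorem arcsOf_subset_oddArcs (hn : 1 ≤ n) (P N : Finset (OddVertex n)) :
    arcsOf P N ⊆ oddArcs n := by
  rw [oddArcs_eq hn]
  exact union_subset_union (image_subset_image (subset_univ _)) (image_subset_image (subset_univ _))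

theorem exists_arcsOf_eq (hn : 1 ≤ n) {R : Finset (OddVertex n × OddVertex n)}
    (hR : R ⊆ oddArcs n) : ∃ P N, R = arcsOf P N := by
  refine ⟨univ.filter fun i => (i - 1, i) ∈ R, univ.filter fun i => (i, i - 1) ∈ R, ?_⟩
  ext e
  constructor
  · intro he
    have := hR he
    rw [oddArcs_eq hn, arcsOf, mem_union, mem_image, mem_image] at this
    rcases this with ⟨i, -, rfl⟩ | ⟨i, -, rfl⟩
    · rw [posArc_mem_arcsOf hn]; simpa using he
    · rw [negArc_mem_arcsOf hn]; simpa using he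
  · intro he
    rw [arcsOf, mem_union, mem_image, mem_image] at he
    rcases he with ⟨i, hi, rfl⟩ | ⟨i, hi, rfl⟩
    · simpa using hi
    · simpa using hi

theorem posArcs_eq (n : ℕ) : posArcs n = arcsOf univ ∅ := by simp [posArcs, arcsOf]

theorem negArcs_eq (n : ℕ) : negArcs n = arcsOf ∅ univ := by simp [negArcs, arcsOf]

theorem arcsOf_inter (hn : 1 ≤ n) (P N P' N' : Finset (OddVertex n)) :
    arcsOf P N ∩ arcsOf P' N' = arcsOf (P ∩ P') (N ∩ N') := by
  obtain ⟨A, B, h⟩ := exists_arcsOf_eq hn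
    (R := arcsOf P N ∩ arcsOf P' N') (inter_subset_left.trans (arcsOf_subset_oddArcs hn _ _))
  rw [h]
  congr 1
  · ext i
    rw [← posArc_mem_arcsOf hn (N := B), ← h]
    simp [posArc_mem_arcsOf hn]
  · ext i
    rw [← negArc_mem_arcsOf hn (P := A), ← h]
    simp [negArc_mem_arcsOf hn]

theorem arcsOf_sdiff (hn : 1 ≤ n) (P N P' N' : Finset (OddVertex n)) :
    arcsOf P N \ arcsOf P' N' = arcsOf (P \ P') (N \ N') := by
  obtain ⟨A, B, h⟩ := exists_arcsOf_eq hn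
    (R := arcsOf P N \ arcsOf P' N') (sdiff_subset.trans (arcsOf_subset_oddArcs hn _ _))
  rw [h]
  congr 1
  · ext i
    rw [← posArc_mem_arcsOf hn (N := B), ← h]
    simp [posArc_mem_arcsOf hn]
  · ext i
    rw [← negArc_mem_arcsOf hn (P := A), ← h]
    simp [negArc_mem_arcsOf hn]

theorem arcsOf_union (P N P' N' : Finset (OddVertex n)) :
    arcsOf P N ∪ arcsOf P' N' = arcsOf (P ∪ P') (N ∪ N') := by
  simp only [arcsOf, image_union]
  exact union_union_union_comm _ _ _ _

theorem rev_arcsOf (P N : Finset (OddVertex n)) : rev (arcsOf P N) = arcsOf N P := by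
  simp only [rev, arcsOf, image_union, image_image]
  exact union_comm _ _

theorem card_arcsOf (hn : 1 ≤ n) (P N : Finset (OddVertex n)) :
    (arcsOf P N).card = P.card + N.card := by
  rw [arcsOf, card_union_of_disjoint, card_image_of_injective _ posArc_injective,
    card_image_of_injective _ negArc_injective]
  rw [disjoint_left]
  simp only [mem_image]
  rintro e ⟨i, -, rfl⟩ ⟨j, -, h⟩
  exact posArc_ne_negArc hn i j h.symm

theorem arcsOf_inter_posArcs (hn : 1 ≤ n) (P N : Finset (OddVertex n)) :
    arcsOf P N ∩ posArcs n = arcsOf P ∅ := by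
  rw [posArcs_eq, arcsOf_inter hn, inter_univ, inter_empty]

theorem arcsOf_inter_negArcs (hn : 1 ≤ n) (P N : Finset (OddVertex n)) :
    arcsOf P N ∩ negArcs n = arcsOf ∅ N := by
  rw [negArcs_eq, arcsOf_inter hn, inter_univ, inter_empty]

theorem card_arcsOf_inter_posArcs (hn : 1 ≤ n) (P N : Finset (OddVertex n)) :
    (arcsOf P N ∩ posArcs n).card = P.card := by
  rw [arcsOf_inter_posArcs hn, card_arcsOf hn, card_empty, add_zero]

theorem card_arcsOf_inter_negArcs (hn : 1 ≤ n) (P N : Finset (OddVertex n)) :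
    (arcsOf P N ∩ negArcs n).card = N.card := by
  rw [arcsOf_inter_negArcs hn, card_arcsOf hn, card_empty, zero_add]

/-- Reversal exchanges the two coordinates of the coding, so `N` moves to the positive side and is
compared with `P`. -/
theorem posArcs_inter_rev_negArcs_eq_empty_iff (hn : 1 ≤ n) (P N : Finset (OddVertex n)) :
    (arcsOf P N ∩ posArcs n) ∩ rev (arcsOf P N ∩ negArcs n) = ∅ ↔ Disjoint P N := by
  rw [arcsOf_inter_posArcs hn, arcsOf_inter_negArcs hn, rev_arcsOf, arcsOf_inter hn,
    inter_empty, ← card_eq_zero, card_arcsOf hn, card_empty, add_zero, card_eq_zero,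
    disjoint_iff_inter_eq_empty]

/-! ### Edge vectors, their single relation, and the dimension -/

/-- The generator of the symmetric edge polytope given by the arc `(i - 1, i)`. -/
noncomputable def edgeVec (i : OddVertex n) : OddVertex n → ℝ := arcVec (i - 1, i)

theorem arcVec_neg (i : OddVertex n) : arcVec (i, i - 1) = -edgeVec i := by
  simp [edgeVec, arcVec]

theorem sum_smul_edgeVec_apply (c : OddVertex n → ℝ) (j : OddVertex n) :
    (∑ i, c i • edgeVec i) j = c (j + 1) - c j := by
  simp only [edgeVec, arcVec, Finset.sum_apply, Pi.smul_apply, Pi.sub_apply, smul_eq_mul, mul_sub,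
    sum_sub_distrib, Pi.single_apply, mul_ite, mul_one, mul_zero]
  simp [eq_sub_iff_add_eq]

theorem eq_of_forall_add_one_eq {c : OddVertex n → ℝ} (h : ∀ j, c (j + 1) = c j)
    (i : OddVertex n) : c i = c 0 := by
  induction i using Fin.induction with
  | zero => rfl
  | succ i ih => rw [← Fin.coeSucc_eq_succ, h, ih]

/-- The coordinates of the combination are the successive differences of `c` around the cycle. -/
theorem sum_smul_edgeVec_eq_zero_iff (c : OddVertex n → ℝ) :
    ∑ i, c i • edgeVec i = 0 ↔ ∀ i, c i = c 0 := by
  constructor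
  · intro h
    refine eq_of_forall_add_one_eq fun j => ?_
    have := congrFun h j
    rw [sum_smul_edgeVec_apply] at this
    exact sub_eq_zero.1 this
  · intro h
    ext j
    rw [sum_smul_edgeVec_apply, h, h j, sub_self, Pi.zero_apply]

theorem sum_edgeVec (n : ℕ) : ∑ i : OddVertex n, edgeVec i = 0 := by
  simpa using (sum_smul_edgeVec_eq_zero_iff (n := n) fun _ => 1).2 fun _ => rfl

/-- Linear functionals have arbitrary values on the edge vectors, subject to the sum being zero. -/
theorem exists_functional {x : OddVertex n → ℝ} (hx : ∑ i, x i = 0) :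
    ∃ l : (OddVertex n → ℝ) →ₗ[ℝ] ℝ, ∀ i, l (edgeVec i) = x i := by
  -- Negated partial sums serve as vertex potentials: `f (i - 1) - f i = x i`. The wrap-around step
  -- at `0` is where the total must vanish.
  let f : OddVertex n → ℝ := fun k => -∑ j ∈ Iic k, x j
  refine ⟨∑ k, f k • LinearMap.proj k, fun i => ?_⟩
  have hl : (∑ k, f k • LinearMap.proj k : (OddVertex n → ℝ) →ₗ[ℝ] ℝ) (edgeVec i) =
      f (i - 1) - f i := by
    simp [edgeVec, arcVec, mul_sub, Pi.single_apply]
  rw [hl]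
  simp only [f]
  induction i using Fin.cases with
  | zero =>
    have h1 : (0 - 1 : OddVertex n) = Fin.last (2 * n) := by
      rw [sub_eq_iff_eq_add, Fin.last_add_one]
    have h2 : Iic (0 : OddVertex n) = {0} := by
      ext; simp
    have h3 : Iic (Fin.last (2 * n)) = univ := by
      ext; simp [Fin.le_last]
    rw [h1, h2, h3, hx]
    simp
  | succ i =>
    have h1 : (i.succ - 1 : OddVertex n) = i.castSucc := by
      rw [sub_eq_iff_eq_add, Fin.coeSucc_eq_succ]
    have h2 : Iic i.succ = insert i.succ (Iic i.castSucc) := by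
      ext k
      simp only [mem_Iic, mem_insert, Fin.le_def, Fin.ext_iff, Fin.val_succ, Fin.val_castSucc]
      omega
    rw [h1, h2, sum_insert (by simp)]
    ring

theorem sum_arcsOf {M : Type*} [AddCommMonoid M] (hn : 1 ≤ n) (P N : Finset (OddVertex n))
    (f : OddVertex n × OddVertex n → M) :
    ∑ e ∈ arcsOf P N, f e = ∑ i ∈ P, f (i - 1, i) + ∑ i ∈ N, f (i, i - 1) := by
  rw [arcsOf, sum_union, sum_image posArc_injective.injOn, sum_image negArc_injective.injOn]
  rw [disjoint_left]
  simp only [mem_image]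
  rintro e ⟨i, -, rfl⟩ ⟨j, -, h⟩
  exact posArc_ne_negArc hn i j h.symm

/-- Extended by zero, a relation among these arcs is a relation among all edge vectors, so its
coefficients are constant. Since `|P| + |N| ≤ 2n`, some index is missed and the constant is zero. -/
theorem linearIndepOn_arcsOf (hn : 1 ≤ n) {P N : Finset (OddVertex n)} (hPN : Disjoint P N)
    (hP : P.card ≤ n) (hN : N.card ≤ n) :
    LinearIndepOn ℝ arcVec (arcsOf P N : Set (OddVertex n × OddVertex n)) := by
  rw [linearIndepOn_finset_iff]
  intro g hg
  rw [sum_arcsOf hn] at hg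
  let c : OddVertex n → ℝ := fun i =>
    (if i ∈ P then g (i - 1, i) else 0) - (if i ∈ N then g (i, i - 1) else 0)
  have hc : ∑ i, c i • edgeVec i = 0 := by
    rw [← hg]
    simp only [c, sub_smul, ite_smul, zero_smul, sum_sub_distrib, sum_ite_mem, univ_inter,
      arcVec_neg, smul_neg, sum_neg_distrib]
    exact sub_eq_add_neg _ _
  rw [sum_smul_edgeVec_eq_zero_iff] at hc
  obtain ⟨k, hk⟩ : ∃ k, k ∉ P ∪ N := by
    by_contra! h
    have h1 : P ∪ N = univ := eq_univ_iff_forall.2 h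
    have h2 := card_union_of_disjoint hPN
    rw [h1, card_univ, Fintype.card_fin] at h2
    omega
  rw [mem_union, not_or] at hk
  have hc0 : ∀ i, c i = 0 := fun i => by
    rw [hc i, ← hc k]; simp [c, hk.1, hk.2]
  intro e he
  rw [arcsOf, mem_union, mem_image, mem_image] at he
  rcases he with ⟨i, hi, rfl⟩ | ⟨i, hi, rfl⟩
  · simpa [c, hi, disjoint_left.1 hPN hi] using hc0 i
  · simpa [c, hi, disjoint_right.1 hPN hi] using hc0 i

theorem polyDim_SE (hn : 1 ≤ n) : polyDim (SE (SimpleGraph.cycleGraph (2 * n + 1))) = 2 * n := by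
  let φ : (OddVertex n → ℝ) →ₗ[ℝ] (OddVertex n → ℝ) := Fintype.linearCombination ℝ edgeVec
  have hφ : ∀ c, φ c = ∑ i, c i • edgeVec i := fun c => Fintype.linearCombination_apply ℝ edgeVec c
  have hker : LinearMap.ker φ = Submodule.span ℝ {fun _ => (1 : ℝ)} := by
    ext c
    rw [LinearMap.mem_ker, hφ, sum_smul_edgeVec_eq_zero_iff, Submodule.mem_span_singleton]
    constructor
    · intro h
      exact ⟨c 0, by ext i; simp [h i]⟩
    · rintro ⟨a, rfl⟩ i
      simp
  have hspan : vectorSpan ℝ (DE (oddArcs n)) = LinearMap.range φ := by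
    rw [vectorSpan_DE, Fintype.range_linearCombination]
    apply le_antisymm
    · rw [vectorSpan_def, Submodule.span_le]
      have key : ∀ e ∈ oddArcs n, arcVec e ∈ Submodule.span ℝ (Set.range (edgeVec (n := n))) := by
        intro e he
        rw [oddArcs_eq hn, arcsOf, mem_union, mem_image, mem_image] at he
        rcases he with ⟨i, -, rfl⟩ | ⟨i, -, rfl⟩
        · exact Submodule.subset_span ⟨i, rfl⟩
        · rw [arcVec_neg]
          exact Submodule.neg_mem _ (Submodule.subset_span ⟨i, rfl⟩)
      rintro _ ⟨_, ⟨e, he, rfl⟩, _, ⟨e', he', rfl⟩, rfl⟩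
      exact Submodule.sub_mem _ (key e he) (key e' he')
    · rw [Submodule.span_le]
      rintro _ ⟨i, rfl⟩
      -- The edge vector is half the difference of two opposite generators.
      have h := vsub_mem_vectorSpan ℝ
        (Set.mem_image_of_mem arcVec (show (i - 1, i) ∈ (oddArcs n : Set _) by
          rw [oddArcs_eq hn]; exact (posArc_mem_arcsOf hn).2 (mem_univ _)))
        (Set.mem_image_of_mem arcVec (show (i, i - 1) ∈ (oddArcs n : Set _) by
          rw [oddArcs_eq hn]; exact (negArc_mem_arcsOf hn).2 (mem_univ _)))
      rw [arcVec_neg, vsub_eq_sub, sub_neg_eq_add] at h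
      have h2 := Submodule.smul_mem _ (2⁻¹ : ℝ) h
      have h3 : (2⁻¹ : ℝ) • (arcVec (i - 1, i) + edgeVec i) = edgeVec i := by
        change (2⁻¹ : ℝ) • (edgeVec i + edgeVec i) = edgeVec i
        rw [← two_smul ℝ, smul_smul]; norm_num
      rwa [h3] at h2
  have hrank := φ.finrank_range_add_finrank_ker
  have hone : (fun _ : OddVertex n => (1 : ℝ)) ≠ 0 := fun h => one_ne_zero (congrFun h 0)
  rw [hker, finrank_span_singleton hone, Module.finrank_fintype_fun_eq_card,
    Fintype.card_fin] at hrank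
  rw [SE_eq, polyDim, hspan]
  exact Nat.add_right_cancel hrank

/-! ### Proper faces as pairs of small disjoint sets -/

/-- Disjoint sets of at most `n` positive and `n` negative arcs are cut out by a functional. -/
theorem exists_functional_eq_one_iff (hn : 1 ≤ n) {P N : Finset (OddVertex n)}
    (hPN : Disjoint P N) (hP : P.card ≤ n) (hN : N.card ≤ n) :
    ∃ l : (OddVertex n → ℝ) →ₗ[ℝ] ℝ, ∀ e ∈ oddArcs n,
      l (arcVec e) ≤ 1 ∧ (l (arcVec e) = 1 ↔ e ∈ arcsOf P N) := by
  have hcard : (P ∪ N).card = P.card + N.card := card_union_of_disjoint hPN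
  have hcompl := card_compl (P ∪ N)
  rw [hcard, Fintype.card_fin] at hcompl
  have hr : ((P ∪ N)ᶜ.card : ℝ) = 2 * n + 1 - P.card - N.card := by
    rw [hcompl, Nat.cast_sub (by omega)]
    push_cast
    ring
  have hP' : (P.card : ℝ) ≤ n := by exact_mod_cast hP
  have hN' : (N.card : ℝ) ≤ n := by exact_mod_cast hN
  have hpos : (0 : ℝ) < 2 * n + 1 - P.card - N.card := by linarith
  -- The value `t` off `P ∪ N` is forced by the zero sum. The inequalities `t < 1` and `-1 < t` say
  -- `2|N| < 2n + 1` and `2|P| < 2n + 1`.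
  obtain ⟨t, ht⟩ : ∃ t : ℝ, t = (N.card - P.card) / (2 * n + 1 - P.card - N.card) := ⟨_, rfl⟩
  have ht1 : t < 1 := by rw [ht, div_lt_one hpos]; linarith
  have ht2 : -1 < t := by rw [ht, lt_div_iff₀ hpos]; linarith
  let x : OddVertex n → ℝ := fun i => if i ∈ P then 1 else if i ∈ N then -1 else t
  have hx : ∑ i, x i = 0 := by
    rw [← sum_add_sum_compl (P ∪ N), sum_union hPN]
    have h1 : ∑ i ∈ P, x i = P.card := by
      rw [sum_congr rfl (g := fun _ => (1 : ℝ)) fun i hi => by simp [x, hi]]; simp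
    have h2 : ∑ i ∈ N, x i = -N.card := by
      rw [sum_congr rfl (g := fun _ => (-1 : ℝ)) fun i hi => by
        simp [x, hi, disjoint_right.1 hPN hi]]
      simp
    have h3 : ∑ i ∈ (P ∪ N)ᶜ, x i = (P ∪ N)ᶜ.card * t := by
      rw [sum_congr rfl (g := fun _ => t) fun i hi => by
        rw [mem_compl, mem_union, not_or] at hi
        simp [x, hi]]
      simp
    rw [h1, h2, h3, hr, ht, mul_div_cancel₀ _ hpos.ne']
    ring
  obtain ⟨l, hl⟩ := exists_functional hx
  refine ⟨l, fun e he => ?_⟩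
  rw [oddArcs_eq hn, arcsOf, mem_union, mem_image, mem_image] at he
  rcases he with ⟨i, -, rfl⟩ | ⟨i, -, rfl⟩
  · rw [posArc_mem_arcsOf hn, show l (arcVec (i - 1, i)) = x i from hl i]
    by_cases h1 : i ∈ P
    · simp [x, h1]
    by_cases h2 : i ∈ N
    · norm_num [x, h1, h2]
    · simp [x, h1, h2, ht1.le, ht1.ne]
  · rw [negArc_mem_arcsOf hn, arcVec_neg, map_neg, hl i]
    by_cases h1 : i ∈ P
    · norm_num [x, h1, disjoint_left.1 hPN h1]
    by_cases h2 : i ∈ N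
    · norm_num [x, h1, h2]
    · simp only [x, h1, h2, if_false, iff_false]
      exact ⟨by linarith, by linarith⟩

theorem isExposed_DE_arcsOf (hn : 1 ≤ n) {P N : Finset (OddVertex n)}
    (hPN : Disjoint P N) (hP : P.card ≤ n) (hN : N.card ≤ n) :
    IsExposed ℝ (SE (SimpleGraph.cycleGraph (2 * n + 1))) (DE (arcsOf P N)) := by
  classical
  intro hne
  obtain ⟨e, he⟩ := nonempty_of_DE_nonempty hne
  obtain ⟨l, hl⟩ := exists_functional_eq_one_iff hn hPN hP hN
  have hsub := arcsOf_subset_oddArcs hn P N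
  refine ⟨LinearMap.toContinuousLinearMap l, ?_⟩
  have h := maximizers_DE (R := oddArcs n) l (M := 1) (fun e he => (hl e he).1)
    ⟨e, hsub he, (hl e (hsub he)).2.2 he⟩
  have hf : ((oddArcs n).filter fun e => l (arcVec e) = 1) = arcsOf P N := by
    ext e
    rw [mem_filter]
    exact ⟨fun h => (hl e h.1).2.1 h.2, fun h => ⟨hsub h, (hl e (hsub h)).2.2 h⟩⟩
  rw [hf] at h
  exact h.symm

/-- As `1 ≤ n`, a single arc is an admissible pair, so some functional attains its maximum over the
generators at `e` alone. Thus generators are vertices, and a polytope `DE R` determines `R`. -/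
theorem mem_of_arcVec_mem_DE (hn : 1 ≤ n) {R : Finset (OddVertex n × OddVertex n)}
    (hR : R ⊆ oddArcs n) {e : OddVertex n × OddVertex n} (he : e ∈ oddArcs n)
    (h : arcVec e ∈ DE R) : e ∈ R := by
  classical
  obtain ⟨P, N, hPN, hP, hN, heq⟩ : ∃ P N : Finset (OddVertex n),
      Disjoint P N ∧ P.card ≤ n ∧ N.card ≤ n ∧ arcsOf P N = {e} := by
    rw [oddArcs_eq hn, arcsOf, mem_union, mem_image, mem_image] at he
    rcases he with ⟨i, -, rfl⟩ | ⟨i, -, rfl⟩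
    · exact ⟨{i}, ∅, by simp, by simpa using hn, by simp, by simp [arcsOf]⟩
    · exact ⟨∅, {i}, by simp, by simp, by simpa using hn, by simp [arcsOf]⟩
  obtain ⟨l, hl⟩ := exists_functional_eq_one_iff hn hPN hP hN
  rw [heq] at hl
  have h1 := (le_and_mem_DE_filter l (fun e he => (hl e (hR he)).1) h).2
    ((hl e he).2.2 (mem_singleton_self e))
  obtain ⟨e', he'⟩ := nonempty_of_DE_nonempty ⟨_, h1⟩
  rw [mem_filter] at he'
  rw [← mem_singleton.1 ((hl e' (hR he'.1)).2.1 he'.2)]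
  exact he'.1

theorem DE_injOn (hn : 1 ≤ n) : Set.InjOn DE {R | R ⊆ oddArcs n} := by
  intro R hR S hS h
  ext e
  exact ⟨fun he => mem_of_arcVec_mem_DE hn hS (hR he) (h ▸ arcVec_mem_DE he),
    fun he => mem_of_arcVec_mem_DE hn hR (hS he) (h ▸ arcVec_mem_DE he)⟩

theorem DE_arcsOf_inj (hn : 1 ≤ n) {P N P' N' : Finset (OddVertex n)}
    (h : DE (arcsOf P N) = DE (arcsOf P' N')) : P = P' ∧ N = N' :=
  arcsOf_inj hn
    (DE_injOn hn (arcsOf_subset_oddArcs hn P N) (arcsOf_subset_oddArcs hn P' N') h)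

/-- If more than `n` entries equal `M`, at most `n` others remain, each at least `-M`, and the sum
is at least `M > 0`. -/
theorem card_filter_eq_le {x : OddVertex n → ℝ} {M : ℝ} (hM : 0 < M) (hx : ∑ i, x i = 0)
    (hle : ∀ i, -M ≤ x i) : (univ.filter fun i => x i = M).card ≤ n := by
  by_contra! hlt
  set S := univ.filter fun i => x i = M with hS
  have h1 : ∑ i ∈ S, x i = S.card * M := by
    rw [sum_congr rfl (g := fun _ => M) fun i hi => (mem_filter.1 hi).2, sum_const,
      nsmul_eq_mul]
  have h2 : -(Sᶜ.card * M) ≤ ∑ i ∈ Sᶜ, x i := by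
    have := sum_le_sum (s := Sᶜ) (f := fun _ => -M) fun i _ => hle i
    simpa using this
  have hc := card_add_card_compl S
  rw [Fintype.card_fin] at hc
  have hlt' : (Sᶜ.card : ℝ) + 1 ≤ S.card := by
    have : Sᶜ.card + 1 ≤ S.card := by omega
    exact_mod_cast this
  have := mul_le_mul_of_nonneg_right hlt' hM.le
  rw [← sum_add_sum_compl S, h1] at hx
  linarith

theorem exists_arcsOf_of_isExposed (hn : 1 ≤ n) {F : Set (OddVertex n → ℝ)} (hF : F.Nonempty)
    (hexp : IsExposed ℝ (SE (SimpleGraph.cycleGraph (2 * n + 1))) F)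
    (hne : F ≠ SE (SimpleGraph.cycleGraph (2 * n + 1))) :
    ∃ P N : Finset (OddVertex n),
      Disjoint P N ∧ P.card ≤ n ∧ N.card ≤ n ∧ F = DE (arcsOf P N) := by
  classical
  rw [SE_eq] at hexp hne
  obtain ⟨l, hl⟩ := hexp hF
  obtain ⟨k, -, hk⟩ := exists_max_image univ (fun i : OddVertex n => |l (edgeVec i)|)
    ⟨0, mem_univ _⟩
  -- Generators come in opposite pairs, so the largest absolute value on edge vectors is the maximum
  -- of `l` on the polytope.
  set M := |l (edgeVec k)| with hMdef
  have hup : ∀ i, l (edgeVec i) ≤ M := fun i => (le_abs_self _).trans (hk i (mem_univ _))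
  have hlow : ∀ i, -M ≤ l (edgeVec i) := fun i =>
    neg_le.1 ((neg_le_abs _).trans (hk i (mem_univ _)))
  have hle : ∀ e ∈ oddArcs n, l (arcVec e) ≤ M := by
    intro e he
    rw [oddArcs_eq hn, arcsOf, mem_union, mem_image, mem_image] at he
    rcases he with ⟨i, -, rfl⟩ | ⟨i, -, rfl⟩
    · exact hup i
    · rw [arcVec_neg, map_neg]; exact neg_le.1 (hlow i)
  have hmem : ∀ i : OddVertex n, (i - 1, i) ∈ oddArcs n ∧ (i, i - 1) ∈ oddArcs n := fun i => by
    rw [oddArcs_eq hn, posArc_mem_arcsOf hn, negArc_mem_arcsOf hn]; simp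
  have hex : ∃ e ∈ oddArcs n, l (arcVec e) = M := by
    rcases abs_choice (l (edgeVec k)) with h | h
    · exact ⟨_, (hmem k).1, h.symm.trans hMdef.symm⟩
    · refine ⟨_, (hmem k).2, ?_⟩
      rw [arcVec_neg, map_neg, hMdef, h]
  have hface := maximizers_DE (R := oddArcs n) (l : (OddVertex n → ℝ) →ₗ[ℝ] ℝ) hle hex
  have hF' : F = DE ((oddArcs n).filter fun e => l (arcVec e) = M) := hl.trans hface
  -- If `M = 0`, then `l` vanishes on all generators and the face is the whole polytope.
  rcases (abs_nonneg (l (edgeVec k))).eq_or_lt with h0 | hM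
  · exfalso
    refine hne (hF'.trans ?_)
    congr 1
    refine filter_true_of_mem fun e he => ?_
    rw [← hMdef] at h0
    rw [oddArcs_eq hn, arcsOf, mem_union, mem_image, mem_image] at he
    have hz : ∀ i, l (edgeVec i) = 0 := fun i =>
      le_antisymm (h0 ▸ hup i) (by have := hlow i; rwa [← h0, neg_zero] at this)
    rcases he with ⟨i, -, rfl⟩ | ⟨i, -, rfl⟩
    · exact (hz i).trans h0
    · rw [arcVec_neg, map_neg, hz, neg_zero, h0]
  rw [← hMdef] at hM
  have hsum : ∑ i : OddVertex n, l (edgeVec i) = 0 := by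
    rw [← map_sum, sum_edgeVec, map_zero]
  refine ⟨univ.filter fun i => l (edgeVec i) = M, univ.filter fun i => -l (edgeVec i) = M,
    ?_, card_filter_eq_le hM hsum hlow, ?_, ?_⟩
  · rw [disjoint_left]
    intro i h1 h2
    have h1 := (mem_filter.1 h1).2
    have h2 := (mem_filter.1 h2).2
    linarith
  · exact card_filter_eq_le hM (by rw [sum_neg_distrib, hsum, neg_zero])
      fun i => neg_le_neg (hup i)
  · rw [hF']
    congr 1
    obtain ⟨P, N, h⟩ := exists_arcsOf_eq hn (filter_subset (fun e => l (arcVec e) = M) (oddArcs n))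
    rw [h]
    congr 1
    · ext i
      rw [← posArc_mem_arcsOf hn (N := N), ← h, mem_filter, mem_filter]
      simp only [(hmem i).1, mem_univ, true_and]
      rfl
    · ext i
      rw [← negArc_mem_arcsOf hn (P := P), ← h, mem_filter, mem_filter, arcVec_neg, map_neg]
      simp only [(hmem i).2, mem_univ, true_and]

theorem isFaceOfDim_iff (hn : 1 ≤ n) {d : ℕ} (hd : d < 2 * n) (F : Set (OddVertex n → ℝ)) :
    IsFaceOfDim (SE (SimpleGraph.cycleGraph (2 * n + 1))) d F ↔
      ∃ P N : Finset (OddVertex n), Disjoint P N ∧ P.card ≤ n ∧ N.card ≤ n ∧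
        P.card + N.card = d + 1 ∧ F = DE (arcsOf P N) := by
  constructor
  · rintro ⟨hF, hexp, hdim⟩
    -- The bound `d < 2n` excludes the whole polytope, the only face not given by such a pair.
    obtain ⟨P, N, hPN, hP, hN, rfl⟩ := exists_arcsOf_of_isExposed hn hF hexp (by
      rintro rfl
      rw [polyDim_SE hn] at hdim
      omega)
    refine ⟨P, N, hPN, hP, hN, ?_, rfl⟩
    have hpos := card_pos.2 (nonempty_of_DE_nonempty hF)
    rw [polyDim_DE_of_linearIndepOn (d := (arcsOf P N).card - 1)
      (linearIndepOn_arcsOf hn hPN hP hN) (by omega), card_arcsOf hn] at hdim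
    rw [card_arcsOf hn] at hpos
    omega
  · rintro ⟨P, N, hPN, hP, hN, hcard, rfl⟩
    rw [← card_arcsOf hn] at hcard
    exact ⟨DE_nonempty (card_pos.1 (by omega)), isExposed_DE_arcsOf hn hPN hP hN,
      polyDim_DE_of_linearIndepOn (linearIndepOn_arcsOf hn hPN hP hN) hcard⟩

theorem isFaceOfDim_arcsOf_iff (hn : 1 ≤ n) {d : ℕ} (hd : d < 2 * n)
    (P N : Finset (OddVertex n)) :
    IsFaceOfDim (SE (SimpleGraph.cycleGraph (2 * n + 1))) d (DE (arcsOf P N)) ↔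
      Disjoint P N ∧ P.card ≤ n ∧ N.card ≤ n ∧ P.card + N.card = d + 1 := by
  rw [isFaceOfDim_iff hn hd]
  constructor
  · rintro ⟨P', N', h1, h2, h3, h4, h⟩
    obtain ⟨rfl, rfl⟩ := DE_arcsOf_inj hn h
    exact ⟨h1, h2, h3, h4⟩
  · rintro ⟨h1, h2, h3, h4⟩
    exact ⟨P, N, h1, h2, h3, h4, rfl⟩

theorem isFacet_iff_isFaceOfDim (hn : 1 ≤ n) (F : Set (OddVertex n → ℝ)) :
    IsFacet (SE (SimpleGraph.cycleGraph (2 * n + 1))) F ↔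
      IsFaceOfDim (SE (SimpleGraph.cycleGraph (2 * n + 1))) (2 * n - 1) F := by
  rw [IsFacet, IsFaceOfDim, polyDim_SE hn]
  have : polyDim F + 1 = 2 * n ↔ polyDim F = 2 * n - 1 := by omega
  rw [this]

/-- Two sizes at most `n` with sum `2n` must both equal `n`. -/
theorem isFacet_iff (hn : 1 ≤ n) (F : Set (OddVertex n → ℝ)) :
    IsFacet (SE (SimpleGraph.cycleGraph (2 * n + 1))) F ↔
      ∃ P N : Finset (OddVertex n), Disjoint P N ∧ P.card = n ∧ N.card = n ∧
        F = DE (arcsOf P N) := by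
  rw [isFacet_iff_isFaceOfDim hn, isFaceOfDim_iff hn (by omega)]
  constructor
  · rintro ⟨P, N, h1, h2, h3, h4, h⟩
    exact ⟨P, N, h1, by omega, by omega, h⟩
  · rintro ⟨P, N, h1, h2, h3, h⟩
    exact ⟨P, N, h1, by omega, by omega, by omega, h⟩

theorem isFacet_arcsOf_iff (hn : 1 ≤ n) (P N : Finset (OddVertex n)) :
    IsFacet (SE (SimpleGraph.cycleGraph (2 * n + 1))) (DE (arcsOf P N)) ↔
      Disjoint P N ∧ P.card = n ∧ N.card = n := by
  rw [isFacet_iff hn]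
  constructor
  · rintro ⟨P', N', h1, h2, h3, h⟩
    obtain ⟨rfl, rfl⟩ := DE_arcsOf_inj hn h
    exact ⟨h1, h2, h3⟩
  · rintro ⟨h1, h2, h3⟩
    exact ⟨P, N, h1, h2, h3, rfl⟩

theorem isSimplexOfDim_of_isFacet (hn : 1 ≤ n) {F : Set (OddVertex n → ℝ)}
    (hF : IsFacet (SE (SimpleGraph.cycleGraph (2 * n + 1))) F) :
    IsSimplexOfDim (2 * n - 1) F := by
  obtain ⟨P, N, hPN, hP, hN, rfl⟩ := (isFacet_iff hn F).1 hF
  exact isSimplexOfDim_DE_of_linearIndepOn (linearIndepOn_arcsOf hn hPN hP.le hN.le)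
    (by rw [card_arcsOf hn]; omega)

theorem isSimplicial_SE (hn : 1 ≤ n) :
    IsSimplicial (SE (SimpleGraph.cycleGraph (2 * n + 1))) := by
  intro F hF hexp hne
  obtain ⟨P, N, hPN, hP, hN, rfl⟩ := exists_arcsOf_of_isExposed hn hF hexp hne
  have hpos := card_pos.2 (nonempty_of_DE_nonempty hF)
  exact ⟨(arcsOf P N).card - 1, isSimplexOfDim_DE_of_linearIndepOn
    (linearIndepOn_arcsOf hn hPN hP hN) (by omega)⟩

/-! ### Coconnectivity -/

theorem underlying_mono {V : Type*} {R S : Finset (V × V)} (h : R ⊆ S) :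
    underlying R ≤ underlying S := by
  intro v w hvw
  rw [underlying, SimpleGraph.fromRel_adj] at hvw ⊢
  exact ⟨hvw.1, hvw.2.imp (fun h' => h h') fun h' => h h'⟩

/-- A set of arcs that misses at most one edge of the cycle is connected. -/
theorem connected_underlying_arcsOf (hn : 1 ≤ n) {P N : Finset (OddVertex n)} (k : OddVertex n)
    (h : ∀ i, i ≠ k → i ∈ P ∪ N) : (underlying (arcsOf P N)).Connected := by
  have hone : (1 : OddVertex n) ≠ 0 := fun h0 => one_ne_neg_one hn (by rw [h0, neg_zero])
  have hadj : ∀ i, i ≠ k → (underlying (arcsOf P N)).Adj (i - 1) i := by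
    intro i hi
    rw [underlying, SimpleGraph.fromRel_adj]
    refine ⟨fun h' => hone (by simpa using h'), ?_⟩
    rw [posArc_mem_arcsOf hn, negArc_mem_arcsOf hn]
    exact mem_union.1 (h i hi)
  -- Walk once around from `k`; the only step that could use the missing edge would be the last one,
  -- back into `k`, and it is never taken.
  have hreach : ∀ j : OddVertex n, (underlying (arcsOf P N)).Reachable k (k + j) := by
    intro j
    induction j using Fin.induction with
    | zero => rw [add_zero]
    | succ j ih =>
      refine ih.trans (SimpleGraph.Adj.reachable ?_)
      have hsucc : k + j.succ - 1 = k + j.castSucc := by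
        rw [← Fin.coeSucc_eq_succ, ← add_assoc, add_sub_cancel_right]
      rw [← hsucc]
      exact hadj _ fun h' => Fin.succ_ne_zero j (left_eq_add.1 h'.symm)
  have hreach' : ∀ v, (underlying (arcsOf P N)).Reachable k v := fun v => by
    simpa using hreach (v - k)
  exact ⟨fun u v => (hreach' u).symm.trans (hreach' v)⟩

/-- Exactly one edge of the cycle is missed, so the graph is still connected. The coconnectivity
condition on facets therefore follows from the other conditions. -/
theorem coconnectivity_arcsOf (hn : 1 ≤ n) {P N : Finset (OddVertex n)} (hPN : Disjoint P N)
    (hP : P.card = n) (hN : N.card = n) :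
    coconnectivity (arcsOf P N) = coconnectivity (oddArcs n) := by
  have hcard := card_compl (P ∪ N)
  rw [card_union_of_disjoint hPN, Fintype.card_fin] at hcard
  obtain ⟨k, hk⟩ := card_eq_one.1 (show (P ∪ N)ᶜ.card = 1 by omega)
  have h1 : (underlying (arcsOf P N)).Connected := by
    refine connected_underlying_arcsOf hn k fun i hi => ?_
    by_contra h'
    rw [← mem_compl, hk, mem_singleton] at h'
    exact hi h'
  have h2 : (underlying (oddArcs n)).Connected :=
    h1.mono (underlying_mono (arcsOf_subset_oddArcs hn P N))
  have key : ∀ R : Finset (OddVertex n × OddVertex n), (underlying R).Connected →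
      Nat.card (underlying R).ConnectedComponent = 1 := by
    intro R hR
    have := hR.preconnected.subsingleton_connectedComponent
    have : Nonempty (underlying R).ConnectedComponent :=
      ⟨(underlying R).connectedComponentMk 0⟩
    exact Nat.card_eq_one_iff_unique.2 ⟨inferInstance, inferInstance⟩
  rw [coconnectivity, coconnectivity, key _ h1, key _ h2]

/-! ### Counting faces -/

/-- The pairs of disjoint sets with at most `n` elements each and `d + 1` elements in total. -/
def disjointPairs (n d : ℕ) : Finset (Finset (OddVertex n) × Finset (OddVertex n)) :=
  univ.filter fun p =>
    Disjoint p.1 p.2 ∧ p.1.card ≤ n ∧ p.2.card ≤ n ∧ p.1.card + p.2.card = d + 1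

theorem mem_disjointPairs {d : ℕ} {p : Finset (OddVertex n) × Finset (OddVertex n)} :
    p ∈ disjointPairs n d ↔
      Disjoint p.1 p.2 ∧ p.1.card ≤ n ∧ p.2.card ≤ n ∧ p.1.card + p.2.card = d + 1 := by
  simp [disjointPairs]

theorem card_disjointPairs (n d : ℕ) : (disjointPairs n d).card =
    ∑ i ∈ indexSet n d, (2 * n + 1).choose i * (2 * n + 1 - i).choose (d + 1 - i) := by
  -- Sort by `i = |P|`, then choose `P`, then `N` inside the complement of `P`.
  have h : (disjointPairs n d).card = ((indexSet n d).sigma fun i =>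
      (powersetCard i (univ : Finset (OddVertex n))).sigma fun P =>
        powersetCard (d + 1 - i) Pᶜ).card := by
    refine card_nbij' (fun p => ⟨p.1.card, p.1, p.2⟩) (fun q => (q.2.1, q.2.2)) ?_ ?_ ?_ ?_
    · intro p hp
      obtain ⟨h1, h2, h3, h4⟩ := mem_disjointPairs.1 hp
      simp only [indexSet, coe_sigma, Set.mem_sigma_iff, mem_coe, mem_filter, mem_range,
        mem_powersetCard, subset_univ, true_and]
      exact ⟨⟨by omega, h2, by omega⟩, subset_compl_iff_disjoint_left.2 h1, by omega⟩
    · rintro ⟨i, P, N⟩ hq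
      simp only [indexSet, coe_sigma, Set.mem_sigma_iff, mem_coe, mem_filter, mem_range,
        mem_powersetCard, subset_univ, true_and] at hq
      obtain ⟨⟨h1, h2, h3⟩, rfl, h4, h5⟩ := hq
      exact mem_disjointPairs.2 ⟨subset_compl_iff_disjoint_left.1 h4, h2, by dsimp; omega,
        by dsimp; omega⟩
    · intro p _
      rfl
    · rintro ⟨i, P, N⟩ hq
      simp only [coe_sigma, Set.mem_sigma_iff, mem_coe, mem_powersetCard] at hq
      obtain ⟨-, ⟨-, rfl⟩, -⟩ := hq
      rfl
  rw [h, card_sigma]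
  refine sum_congr rfl fun i _ => ?_
  rw [card_sigma, sum_congr rfl (g := fun _ => (2 * n + 1 - i).choose (d + 1 - i)) fun P hP => by
    rw [card_powersetCard, card_compl, (mem_powersetCard.1 hP).2, Fintype.card_fin]]
  rw [sum_const, card_powersetCard, card_univ, Fintype.card_fin, smul_eq_mul]

theorem faceCount_SE (hn : 1 ≤ n) {d : ℕ} (hd : d < 2 * n) :
    faceCount (SE (SimpleGraph.cycleGraph (2 * n + 1))) d =
      ∑ i ∈ indexSet n d, (2 * n + 1).choose i * (2 * n + 1 - i).choose (d + 1 - i) := by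
  have h : {F | IsFaceOfDim (SE (SimpleGraph.cycleGraph (2 * n + 1))) d F} =
      (fun p : Finset (OddVertex n) × Finset (OddVertex n) => DE (arcsOf p.1 p.2)) ''
        (disjointPairs n d : Set _) := by
    ext F
    rw [Set.mem_ofPred_eq, isFaceOfDim_iff hn hd]
    constructor
    · rintro ⟨P, N, h1, h2, h3, h4, rfl⟩
      exact ⟨(P, N), mem_disjointPairs.2 ⟨h1, h2, h3, h4⟩, rfl⟩
    · rintro ⟨⟨P, N⟩, hp, rfl⟩
      obtain ⟨h1, h2, h3, h4⟩ := mem_disjointPairs.1 hp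
      exact ⟨P, N, h1, h2, h3, h4, rfl⟩
  rw [faceCount, h, Set.ncard_image_of_injective, Set.ncard_coe_finset, card_disjointPairs]
  rintro ⟨P, N⟩ ⟨P', N'⟩ h
  obtain ⟨rfl, rfl⟩ := DE_arcsOf_inj hn h
  rfl

/-- Choosing `P` and then `N` amounts to choosing `P ∪ N` and then `P` inside it. -/
theorem faceCount_SE_eq_choose_mul (hn : 1 ≤ n) {d : ℕ} (hd : d < 2 * n) :
    faceCount (SE (SimpleGraph.cycleGraph (2 * n + 1))) d =
      (2 * n + 1).choose (d + 1) * ∑ i ∈ indexSet n d, (d + 1).choose i := by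
  rw [faceCount_SE hn hd, mul_sum]
  refine sum_congr rfl fun i hi => (Nat.choose_mul ?_).symm
  have := (mem_filter.1 hi).1
  rw [mem_range] at this
  omega

theorem sum_indexSet_choose {d : ℕ} (hd : d + 1 < n) :
    ∑ i ∈ indexSet n d, (d + 1).choose i = 2 ^ (d + 1) := by
  -- Both size bounds hold automatically when `d + 1 < n`.
  have : indexSet n d = range (d + 1 + 1) := by
    refine filter_true_of_mem fun i hi => ?_
    rw [mem_range] at hi
    omega
  rw [this, Nat.sum_range_choose]

theorem ncard_isFacet (hn : 1 ≤ n) :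
    Set.ncard {F | IsFacet (SE (SimpleGraph.cycleGraph (2 * n + 1))) F} =
      (n + 1) * (2 * n + 1).choose n := by
  have h : indexSet n (2 * n - 1) = {n} := by
    ext i
    simp only [indexSet, mem_filter, mem_range, mem_singleton]
    omega
  have h2 := faceCount_SE hn (d := 2 * n - 1) (by omega)
  rw [h, sum_singleton, show 2 * n + 1 - n = n + 1 by omega, show 2 * n - 1 + 1 - n = n by omega,
    Nat.choose_succ_self_right, mul_comm _ (n + 1)] at h2
  rw [← h2, faceCount]
  simp only [isFacet_iff_isFaceOfDim hn]

theorem succ_mul_choose_mul_factorial (n : ℕ) :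
    (n + 1) * (2 * n + 1).choose n * (n.factorial * n.factorial) = (2 * n + 1).factorial := by
  rw [← Nat.choose_mul_factorial_mul_factorial (show n ≤ 2 * n + 1 by omega),
    show 2 * n + 1 - n = n + 1 by omega, Nat.factorial_succ]
  ring

theorem succ_mul_choose_eq (n : ℕ) :
    (n + 1) * (2 * n + 1).choose n = (2 * n + 1) * (2 * n).choose n := by
  have h := Nat.add_one_mul_choose_eq (2 * n) n
  rw [h, mul_comm, Nat.choose_symm_half]

/-! ### Facets as pairs `(E, e)` -/

/-- The set `E` encodes `P`, and the negative arcs outside `-E` lie over the `n + 1` elements of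
`Pᶜ`. Deleting `e` leaves `N`, so `e` records the one index missed by `P ∪ N`. -/
theorem bijOn_facets (hn : 1 ≤ n) :
    Set.BijOn
      (fun q : Finset (OddVertex n × OddVertex n) × (OddVertex n × OddVertex n) =>
        DE (q.1 ∪ (negArcs n \ rev q.1).erase q.2))
      {q | q.1 ⊆ posArcs n ∧ q.1.card = n ∧ q.2 ∈ negArcs n \ rev q.1}
      {F | IsFacet (SE (SimpleGraph.cycleGraph (2 * n + 1))) F} := by
  have key : ∀ q : Finset (OddVertex n × OddVertex n) × (OddVertex n × OddVertex n),
      (q.1 ⊆ posArcs n ∧ q.1.card = n ∧ q.2 ∈ negArcs n \ rev q.1) ↔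
      ∃ (P : Finset (OddVertex n)) (k : OddVertex n), P.card = n ∧ k ∉ P ∧
        q = (arcsOf P ∅, (k, k - 1)) := by
    rintro ⟨E, e⟩
    constructor
    · rintro ⟨h1, h2, h3⟩
      have hsub : E ⊆ oddArcs n :=
        h1.trans (posArcs_eq n ▸ arcsOf_subset_oddArcs hn _ _)
      obtain ⟨P, N, rfl⟩ := exists_arcsOf_eq hn hsub
      have hN : N = ∅ := by
        have h := inter_eq_left.2 h1
        rw [arcsOf_inter_posArcs hn] at h
        exact (arcsOf_inj hn h).2.symm
      subst hN
      rw [card_arcsOf hn, card_empty, add_zero] at h2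
      rw [rev_arcsOf, negArcs_eq, arcsOf_sdiff hn, arcsOf, mem_union, mem_image, mem_image] at h3
      rcases h3 with ⟨i, hi, -⟩ | ⟨k, hk, rfl⟩
      · simp at hi
      · exact ⟨P, k, h2, (mem_sdiff.1 hk).2, rfl⟩
    · rintro ⟨P, k, h1, h2, h⟩
      obtain ⟨rfl, rfl⟩ := Prod.mk.inj h
      dsimp only
      refine ⟨?_, ?_, ?_⟩
      · rw [← arcsOf_inter_posArcs hn P ∅]; exact inter_subset_right
      · rw [card_arcsOf hn, card_empty, add_zero, h1]
      · rw [rev_arcsOf, negArcs_eq, arcsOf_sdiff hn, negArc_mem_arcsOf hn]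
        simpa using h2
  have hval : ∀ (P : Finset (OddVertex n)) (k : OddVertex n),
      arcsOf P ∅ ∪ (negArcs n \ rev (arcsOf P ∅)).erase (k, k - 1) = arcsOf P (Pᶜ.erase k) := by
    intro P k
    have hs : ({(k, k - 1)} : Finset (OddVertex n × OddVertex n)) = arcsOf ∅ {k} := by
      simp [arcsOf]
    rw [rev_arcsOf, negArcs_eq, arcsOf_sdiff hn, erase_eq, hs, arcsOf_sdiff hn, arcsOf_union,
      erase_eq, compl_eq_univ_sdiff]
    simp
  refine ⟨?_, ?_, ?_⟩
  · intro q hq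
    obtain ⟨P, k, h1, h2, rfl⟩ := (key q).1 hq
    simp only [Set.mem_ofPred_eq, hval]
    rw [isFacet_arcsOf_iff hn]
    refine ⟨disjoint_of_subset_right (erase_subset _ _) disjoint_compl_right, h1, ?_⟩
    rw [card_erase_of_mem (mem_compl.2 h2), card_compl, Fintype.card_fin]
    omega
  · intro q hq q' hq' h
    obtain ⟨P, k, h1, h2, rfl⟩ := (key q).1 hq
    obtain ⟨P', k', h1', h2', rfl⟩ := (key q').1 hq'
    simp only [hval] at h
    obtain ⟨rfl, h⟩ := DE_arcsOf_inj hn h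
    have hk := erase_injOn (Pᶜ) (mem_coe.2 (mem_compl.2 h2)) (mem_coe.2 (mem_compl.2 h2')) h
    rw [hk]
  · intro F hF
    obtain ⟨P, N, hPN, hP, hN, rfl⟩ := (isFacet_iff hn F).1 hF
    have hsub : N ⊆ Pᶜ := subset_compl_iff_disjoint_left.2 hPN
    have hcard : (Pᶜ \ N).card = 1 := by
      rw [card_sdiff_of_subset hsub, card_compl, Fintype.card_fin]
      omega
    obtain ⟨k, hk⟩ := card_eq_one.1 hcard
    have hk' : k ∈ Pᶜ \ N := hk ▸ mem_singleton_self k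
    refine ⟨(arcsOf P ∅, (k, k - 1)), (key _).2 ⟨P, k, hP, ?_, rfl⟩, ?_⟩
    · exact mem_compl.1 (mem_sdiff.1 hk').1
    · simp only [hval]
      rw [erase_eq, ← hk, Finset.sdiff_sdiff_eq_self hsub]

end OddCycle

end SymEdge

theorem mainTheorem6 (n : ℕ) (hn : 1 ≤ n) :
    -- dimension
    SymEdge.polyDim (SymEdge.SE (SimpleGraph.cycleGraph (2 * n + 1))) = 2 * n ∧
    -- description of the facets
    (∀ R ⊆ SymEdge.oddArcs n, SymEdge.polyDim (SymEdge.DE R) = 2 * n - 1 →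
      (SymEdge.IsFacet (SymEdge.SE (SimpleGraph.cycleGraph (2 * n + 1))) (SymEdge.DE R) ↔
        SymEdge.coconnectivity R = SymEdge.coconnectivity (SymEdge.oddArcs n) ∧
        (R ∩ SymEdge.posArcs n).card = n ∧ (R ∩ SymEdge.negArcs n).card = n ∧
        (R ∩ SymEdge.posArcs n) ∩ SymEdge.rev (R ∩ SymEdge.negArcs n) = ∅)) ∧
    -- facets are simplices, and so are all proper faces
    (∀ F, SymEdge.IsFacet (SymEdge.SE (SimpleGraph.cycleGraph (2 * n + 1))) F →
      SymEdge.IsSimplexOfDim (2 * n - 1) F) ∧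
    SymEdge.IsSimplicial (SymEdge.SE (SimpleGraph.cycleGraph (2 * n + 1))) ∧
    -- facets correspond to pairs `(E, e)`
    Set.BijOn
      (fun q : Finset (SymEdge.OddVertex n × SymEdge.OddVertex n) ×
          (SymEdge.OddVertex n × SymEdge.OddVertex n) =>
        SymEdge.DE (q.1 ∪ (SymEdge.negArcs n \ SymEdge.rev q.1).erase q.2))
      {q | q.1 ⊆ SymEdge.posArcs n ∧ q.1.card = n ∧ q.2 ∈ SymEdge.negArcs n \ SymEdge.rev q.1}
      {F | SymEdge.IsFacet (SymEdge.SE (SimpleGraph.cycleGraph (2 * n + 1))) F} ∧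
    -- number of facets
    Set.ncard {F | SymEdge.IsFacet (SymEdge.SE (SimpleGraph.cycleGraph (2 * n + 1))) F} =
      (n + 1) * (2 * n + 1).choose n ∧
    Set.ncard {F | SymEdge.IsFacet (SymEdge.SE (SimpleGraph.cycleGraph (2 * n + 1))) F} *
      (n.factorial * n.factorial) = (2 * n + 1).factorial ∧
    Set.ncard {F | SymEdge.IsFacet (SymEdge.SE (SimpleGraph.cycleGraph (2 * n + 1))) F} =
      (2 * n + 1) * (2 * n).choose n ∧
    -- description and number of the faces of dimension `d < 2n - 2`
    (∀ d : ℕ, d + 2 < 2 * n →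
      (∀ R ⊆ SymEdge.oddArcs n,
        (SymEdge.IsFaceOfDim (SymEdge.SE (SimpleGraph.cycleGraph (2 * n + 1))) d (SymEdge.DE R) ↔
          R.card = d + 1 ∧
          (R ∩ SymEdge.posArcs n).card ≤ n ∧ (R ∩ SymEdge.negArcs n).card ≤ n ∧
          (R ∩ SymEdge.posArcs n) ∩ SymEdge.rev (R ∩ SymEdge.negArcs n) = ∅)) ∧
      SymEdge.faceCount (SymEdge.SE (SimpleGraph.cycleGraph (2 * n + 1))) d =
        ∑ i ∈ SymEdge.indexSet n d,
          (2 * n + 1).choose i * (2 * n + 1 - i).choose (d + 1 - i) ∧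
      SymEdge.faceCount (SymEdge.SE (SimpleGraph.cycleGraph (2 * n + 1))) d =
        (2 * n + 1).choose (d + 1) * ∑ i ∈ SymEdge.indexSet n d, (d + 1).choose i) ∧
    -- the case `d + 1 < n`
    (∀ d : ℕ, d + 1 < n →
      ∑ i ∈ SymEdge.indexSet n d, (d + 1).choose i = 2 ^ (d + 1) ∧
      SymEdge.faceCount (SymEdge.SE (SimpleGraph.cycleGraph (2 * n + 1))) d =
        (2 * n + 1).choose (d + 1) * 2 ^ (d + 1)) := by
  refine ⟨SymEdge.polyDim_SE hn, ?_, fun F hF => SymEdge.isSimplexOfDim_of_isFacet hn hF,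
    SymEdge.isSimplicial_SE hn, SymEdge.bijOn_facets hn, SymEdge.ncard_isFacet hn, ?_, ?_, ?_, ?_⟩
  · intro R hR _
    obtain ⟨P, N, rfl⟩ := SymEdge.exists_arcsOf_eq hn hR
    rw [SymEdge.isFacet_arcsOf_iff hn, SymEdge.card_arcsOf_inter_posArcs hn,
      SymEdge.card_arcsOf_inter_negArcs hn, SymEdge.posArcs_inter_rev_negArcs_eq_empty_iff hn]
    exact ⟨fun ⟨h1, h2, h3⟩ => ⟨SymEdge.coconnectivity_arcsOf hn h1 h2 h3, h2, h3, h1⟩,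
      fun ⟨_, h2, h3, h1⟩ => ⟨h1, h2, h3⟩⟩
  · rw [SymEdge.ncard_isFacet hn, SymEdge.succ_mul_choose_mul_factorial]
  · rw [SymEdge.ncard_isFacet hn, SymEdge.succ_mul_choose_eq]
  · intro d hd
    refine ⟨fun R hR => ?_, SymEdge.faceCount_SE hn (by omega),
      SymEdge.faceCount_SE_eq_choose_mul hn (by omega)⟩
    obtain ⟨P, N, rfl⟩ := SymEdge.exists_arcsOf_eq hn hR
    rw [SymEdge.isFaceOfDim_arcsOf_iff hn (by omega), SymEdge.card_arcsOf hn,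
      SymEdge.card_arcsOf_inter_posArcs hn, SymEdge.card_arcsOf_inter_negArcs hn,
      SymEdge.posArcs_inter_rev_negArcs_eq_empty_iff hn]
    tauto
  · intro d hd
    rw [SymEdge.faceCount_SE_eq_choose_mul hn (by omega), SymEdge.sum_indexSet_choose hd]
    exact ⟨rfl, rfl⟩
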